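/- For a group $G$ and an endomorphism $\varphi$ of $G$, call $x, y \in G$ $\varphi$-conjugate if $x = z y \varphi(z)^{-1}$ for some $z \in G$; the Reidemeister number $R(\varphi) \in \mathbb{N} \cup \{\infty\}$ is the number of $\varphi$-conjugacy classes, and the Reidemeister spectrum of $G$ is $\mathrm{Spec}_R(G) = \{R(\psi) \mid \psi \in \mathrm{Aut}(G)\}$. For integers $n \ge 0$ and $1 \le e_1 \le e_2 \le \dots \le e_n$, a finite abelian $2$-group is of type $e = (e_1, \dots, e_n)$ if it is isomorphic to $\bigoplus_{i=1}^n \mathbb{Z}/2^{e_i}\mathbb{Z}$ (the trivial group has the empty type, $n = 0$). The $abc$-decomposition of $e$ is constructed as follows. (1) Each maximal constant subsequence $e_i = e_{i+1} = \dots = e_j$ of length at least $2$ forms one $a$-block. (2) Among the remaining entries, going from left to right, each pair of successive entries $e_i, e_{i+1}$ (neither already used in a block) with $e_{i+1} = e_i + 1$ forms one $b$-block. (3) Each entry that still remains forms a $c$-block on its own. Let $b(e)$ and $c(e)$ be the numbers of $b$-blocks and of $c$-blocks. Let $A$ be a finite abelian group whose Sylow $2$-subgroup is of type $e$. Then $$\mathrm{Spec}_R(A)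 = \{ d \in \mathbb{N} \mid d \text{ divides } |A| \text{ and } \nu_2(d) \ge b(e) + c(e) \},$$ where $\nu_2(d)$ is the exponent of $2$ in $d$. -/

import Mathlib

/-- The equivalence relation of `φ`-twisted conjugacy on a group `G`:
`x` and `y` are `φ`-conjugate if `x = z * y * (φ z)⁻¹` for some `z`. -/
def twistedConjSetoid {G : Type*} [Group G] (φ : G →* G) : Setoid G where
  r x y := ∃ z : G, x = z * y * (φ z)⁻¹
  iseqv :=
    { refl := fun x => ⟨1, by simp⟩
      symm := by
        rintro x y ⟨z, rfl⟩
        exact ⟨z⁻¹, by simp [mul_assoc]⟩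
      trans := by
        rintro x y w ⟨z, rfl⟩ ⟨z', rfl⟩
        exact ⟨z * z', by simp [mul_assoc]⟩ }

/-- The Reidemeister number of `φ`: the number (possibly infinite) of `φ`-twisted
conjugacy classes. -/
noncomputable def reidemeisterNumber {G : Type*} [Group G] (φ : G →* G) : ℕ∞ :=
  ENat.card (Quotient (twistedConjSetoid φ))

/-- The Reidemeister spectrum of `G`: the set of Reidemeister numbers of the automorphisms
of `G`. -/
def reidemeisterSpectrum (G : Type*) [Group G] : Set ℕ∞ :=
  {r | ∃ ψ : MulAut G, reidemeisterNumber (ψ : G ≃* G).toMonoidHom = r}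

/-- `P` is an abelian `p`-group of type `e = (e₁ ≤ e₂ ≤ ⋯ ≤ eₙ)`, all `eᵢ ≥ 1`, i.e. it is
isomorphic to `⨁ᵢ ℤ/p^(eᵢ)`. The empty tuple (`n = 0`) is the type of the trivial group. -/
def IsOfType (p : ℕ) {n : ℕ} (e : Fin n → ℕ) (P : Type*) [Group P] : Prop :=
  Monotone e ∧ (∀ i, 1 ≤ e i) ∧
    Nonempty (P ≃* Multiplicative (∀ i : Fin n, ZMod (p ^ e i)))

/-- The three kinds of blocks of an abc-decomposition. -/
inductive ABCBlock : Type
  /-- The block `(x, …, x)` of the given length (at least `2`). -/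
  | a (x length : ℕ) : ABCBlock
  /-- The block `(x, x + 1)`. -/
  | b (x : ℕ) : ABCBlock
  /-- The block `(x)`. -/
  | c (x : ℕ) : ABCBlock

/-- Given the list of maximal constant runs of a sequence, turn the runs of length at least `2`
into a-blocks; scanning the remaining one-element runs from the left, turn neighbours `x, x + 1`
into b-blocks, and whatever is left over into c-blocks. (Runs are never empty.) -/
def blocksOfRuns : List (List ℕ) → List ABCBlock
  | [] => []
  | [] :: t => blocksOfRuns t
  | (x :: _ :: r) :: t => .a x (r.length + 2) :: blocksOfRuns t
  | [x] :: [y] :: t =>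
      if y = x + 1 then .b x :: blocksOfRuns t else .c x :: blocksOfRuns ([y] :: t)
  | [x] :: t => .c x :: blocksOfRuns t

/-- The abc-decomposition of a nondecreasing tuple `e`. `List.splitBy (· == ·)` splits
a list into its maximal constant runs. -/
def abcDecomposition {n : ℕ} (e : Fin n → ℕ) : List ABCBlock :=
  blocksOfRuns ((List.ofFn e).splitBy (· == ·))

/-- `b(e)`: the number of b-blocks in the abc-decomposition of `e`. -/
def numBBlocks {n : ℕ} (e : Fin n → ℕ) : ℕ :=
  (abcDecomposition e).countP fun | .b _ => true | _ => false

/-- `c(e)`: the number of c-blocks in the abc-decomposition of `e`. -/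
def numCBlocks {n : ℕ} (e : Fin n → ℕ) : ℕ :=
  (abcDecomposition e).countP fun | .c _ => true | _ => false

/-!
For a finite abelian group the classes of `φ`-conjugacy are the cosets of the image of `1 - φ`, so
`R(φ)` is the number of fixed points of `φ`. Automorphisms of a direct product of groups of coprime
orders split, so the spectrum of `A` is the product of those of its Sylow `2`-subgroup and of the
complement. In `ℤ/p^x` multiplication by `1 + p^k` has `p^k` fixed points for `1 ≤ k ≤ x`, and in
odd order `-1` has just one, which settles the complement.

Attaining the values for `2`-groups: on `G × H` the automorphism with matrix `(1 g; f 1 + fg)` has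
`|ker f| |ker g|` fixed points. For `ℤ/p^x × ℤ/p^y` this attains all `p^m` with
`|x - y| ≤ m ≤ x + y`, which handles the b-blocks and, together with an automorphism of
`(ℤ/p^x)^3` with a single fixed point, the a-blocks. Multiplication by `1 + p^k` handles the
c-blocks.

Lower bound for `2`-groups: let `T` be the set of least entries of b-blocks and of c-blocks, and let
`V_c` be the group of vectors whose `i`-th coordinate is divisible by `2^(c i)`. With
`a i = #{t ∈ T | t < e i}` and `b i = #{t ∈ T | t ≤ e i}`, an automorphism `φ` satisfies
`(φ - 1) V_a ≤ V_b`: off the diagonal because `T` contains no two consecutive numbers, and at the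
entries `e i ∈ T` because the diagonal coefficient of `φ` at an exponent of multiplicity one is odd.
As `V_b` has index `2^|T|` in `V_a`, the kernel of `φ - 1` has order divisible by `2^|T|`.
-/

open scoped Pointwise

section FixedPointSpectrum

variable {G H : Type*}

/-- The numbers of fixed points of the automorphisms of an additive group. For a finite abelian
group this is the Reidemeister spectrum, and as a set of natural numbers it can be multiplied
pointwise. An automorphism with infinitely many fixed points contributes `0`. -/
def fixedPointSpectrum (G : Type*) [Add G] : Set ℕ :=
  {d | ∃ φ : G ≃+ G, Nat.card (Function.fixedPoints φ) = d}

theorem fixedPointSpectrum_congr [AddGroup G] [AddGroup H] (f : G ≃+ H) :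
    fixedPointSpectrum G = fixedPointSpectrum H := by
  ext d
  refine (AddAut.congr f).toEquiv.exists_congr fun φ => ?_
  refine Eq.congr_left (Nat.card_congr (f.toEquiv.subtypeEquiv fun x => ?_))
  simp [AddAut.congr, Function.IsFixedPt]

theorem card_fixedPoints_prodCongr [AddZeroClass G] [AddZeroClass H] (φ : G ≃+ G) (ψ : H ≃+ H) :
    Nat.card (Function.fixedPoints (φ.prodCongr ψ)) =
      Nat.card (Function.fixedPoints φ) * Nat.card (Function.fixedPoints ψ) := by
  rw [← Nat.card_prod]
  exact Nat.card_congr ((Equiv.subtypeEquivRight fun _ => Prod.ext_iff).trans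
    (Equiv.subtypeProdEquivProd (p := Function.IsFixedPt φ) (q := Function.IsFixedPt ψ)))

theorem fixedPointSpectrum_mul_subset_prod [AddZeroClass G] [AddZeroClass H] :
    fixedPointSpectrum G * fixedPointSpectrum H ⊆ fixedPointSpectrum (G × H) := by
  rintro _ ⟨_, ⟨φ, rfl⟩, _, ⟨ψ, rfl⟩, rfl⟩
  exact ⟨φ.prodCongr ψ, card_fixedPoints_prodCongr φ ψ⟩

theorem prod_fixedPointSpectrum_subset_pi {ι : Type*} [Fintype ι] {G : ι → Type*}
    [∀ i, Add (G i)] : ∏ i, fixedPointSpectrum (G i) ⊆ fixedPointSpectrum (∀ i, G i) := by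
  intro d hd
  obtain ⟨c, hc, rfl⟩ := Set.mem_fintype_prod _ _ |>.1 hd
  choose φ hφ using hc
  refine ⟨AddEquiv.piCongrRight fun i => φ i, ?_⟩
  simp_rw [← hφ, ← Nat.card_pi]
  exact Nat.card_congr ((Equiv.subtypeEquivRight fun _ => funext_iff).trans
    (Equiv.subtypePiEquivPi (p := fun i => Function.IsFixedPt (φ i))))

theorem card_mem_fixedPointSpectrum [Add G] : Nat.card G ∈ fixedPointSpectrum G :=
  ⟨AddEquiv.refl G, Nat.card_congr (Equiv.subtypeUnivEquiv fun _ => rfl)⟩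

theorem one_mem_fixedPointSpectrum [AddZeroClass G] (φ : G ≃+ G) (h : ∀ x, φ x = x → x = 0) :
    1 ∈ fixedPointSpectrum G := by
  refine ⟨φ, Nat.card_eq_one_iff_unique.2 ⟨⟨fun x y => Subtype.ext ?_⟩, ⟨⟨0, map_zero φ⟩⟩⟩⟩
  rw [h x x.2, h y y.2]

theorem dvd_card_of_mem_fixedPointSpectrum [AddGroup G] {d : ℕ} (hd : d ∈ fixedPointSpectrum G) :
    d ∣ Nat.card G := by
  obtain ⟨φ, rfl⟩ := hd
  exact (φ.toAddMonoidHom.eqLocus (AddMonoidHom.id G)).card_addSubgroup_dvd_card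

theorem addMonoidHom_eq_zero_of_coprime_card [AddGroup G] [AddGroup H]
    (h : (Nat.card G).Coprime (Nat.card H)) (f : G →+ H) : f = 0 := by
  ext x
  refine AddMonoid.addOrderOf_eq_one_iff.1
    (Nat.eq_one_of_dvd_coprimes h ?_ (addOrderOf_dvd_natCard _))
  exact (addOrderOf_map_dvd f x).trans (addOrderOf_dvd_natCard x)

theorem exists_eq_prodCongr_of_coprime_card [AddGroup G] [AddGroup H]
    (h : (Nat.card G).Coprime (Nat.card H)) (φ : G × H ≃+ G × H) :
    ∃ (φ₁ : G ≃+ G) (φ₂ : H ≃+ H), φ = φ₁.prodCongr φ₂ := by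
  let restrictLeft (ψ : G × H ≃+ G × H) : G →+ G :=
    (AddMonoidHom.fst G H).comp (ψ.toAddMonoidHom.comp (AddMonoidHom.inl G H))
  let restrictRight (ψ : G × H ≃+ G × H) : H →+ H :=
    (AddMonoidHom.snd G H).comp (ψ.toAddMonoidHom.comp (AddMonoidHom.inr G H))
  have apply_inl (ψ : G × H ≃+ G × H) (x : G) : ψ (x, 0) = (restrictLeft ψ x, 0) :=
    Prod.ext rfl <| DFunLike.congr_fun (addMonoidHom_eq_zero_of_coprime_card h
      ((AddMonoidHom.snd G H).comp (ψ.toAddMonoidHom.comp (AddMonoidHom.inl G H)))) x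
  have apply_inr (ψ : G × H ≃+ G × H) (y : H) : ψ (0, y) = (0, restrictRight ψ y) :=
    Prod.ext (DFunLike.congr_fun (addMonoidHom_eq_zero_of_coprime_card h.symm
      ((AddMonoidHom.fst G H).comp (ψ.toAddMonoidHom.comp (AddMonoidHom.inr G H)))) y) rfl
  have left_comp (ψ : G × H ≃+ G × H) (x : G) :
      restrictLeft ψ.symm (restrictLeft ψ x) = x := by
    simpa [← apply_inl] using (Prod.ext_iff.1 (apply_inl ψ.symm (restrictLeft ψ x))).1.symm
  have right_comp (ψ : G × H ≃+ G × H) (y : H) :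
      restrictRight ψ.symm (restrictRight ψ y) = y := by
    simpa [← apply_inr] using (Prod.ext_iff.1 (apply_inr ψ.symm (restrictRight ψ y))).2.symm
  refine ⟨(restrictLeft φ).toAddEquiv (restrictLeft φ.symm) (AddMonoidHom.ext (left_comp φ))
      (AddMonoidHom.ext (left_comp φ.symm)),
    (restrictRight φ).toAddEquiv (restrictRight φ.symm) (AddMonoidHom.ext (right_comp φ))
      (AddMonoidHom.ext (right_comp φ.symm)), AddEquiv.ext fun x => ?_⟩
  rw [← Prod.fst_add_snd x, map_add, apply_inl, apply_inr]
  simp only [Prod.mk_add_mk, add_zero, zero_add]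
  rfl

theorem fixedPointSpectrum_prod_of_coprime_card [AddGroup G] [AddGroup H]
    (h : (Nat.card G).Coprime (Nat.card H)) :
    fixedPointSpectrum (G × H) = fixedPointSpectrum G * fixedPointSpectrum H := by
  refine subset_antisymm ?_ fixedPointSpectrum_mul_subset_prod
  rintro _ ⟨φ, rfl⟩
  obtain ⟨φ₁, φ₂, rfl⟩ := exists_eq_prodCongr_of_coprime_card h φ
  exact ⟨_, ⟨φ₁, rfl⟩, _, ⟨φ₂, rfl⟩, (card_fixedPoints_prodCongr φ₁ φ₂).symm⟩

end FixedPointSpectrum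

section Reidemeister

variable {A : Type*} [CommGroup A]

theorem twistedConjSetoid_eq_leftRel (φ : A →* A) :
    twistedConjSetoid φ = QuotientGroup.leftRel (MonoidHom.id A / φ).range := by
  ext x y
  rw [QuotientGroup.leftRel_apply]
  refine (Equiv.inv A).exists_congr fun z => ?_
  rw [Equiv.inv_apply, MonoidHom.div_apply, MonoidHom.id_apply, map_inv, div_inv_eq_mul,
    eq_mul_inv_iff_mul_eq, inv_mul_eq_iff_eq_mul, mul_left_comm, eq_inv_mul_iff_mul_eq]

theorem reidemeisterNumber_eq_card_fixedPoints [Finite A] (φ : A →* A) :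
    reidemeisterNumber φ = Nat.card (Function.fixedPoints φ) := by
  rw [reidemeisterNumber, twistedConjSetoid_eq_leftRel]
  change ENat.card (A ⧸ (MonoidHom.id A / φ).range) = _
  rw [ENat.card_eq_coe_natCard, ← Subgroup.index, Subgroup.index_range]
  refine congrArg _ (Nat.card_congr (Equiv.subtypeEquivRight fun x => ?_))
  simp [MonoidHom.mem_ker, Function.IsFixedPt, div_eq_one, eq_comm (a := x)]

theorem reidemeisterSpectrum_eq_image_fixedPointSpectrum [Finite A] :
    reidemeisterSpectrum A = ((↑) : ℕ → ℕ∞) '' fixedPointSpectrum (Additive A) := by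
  ext r
  simp only [reidemeisterSpectrum, reidemeisterNumber_eq_card_fixedPoints, fixedPointSpectrum,
    Set.mem_image, Set.mem_ofPred_eq, exists_exists_eq_and]
  exact MulEquiv.toAdditive.exists_congr fun _ => Iff.rfl

end Reidemeister

section ZMod

variable {A : Type*} [AddGroup A] {p : ℕ}

theorem card_ker_mul_addOrderOf_apply_one {n : ℕ} (f : ZMod n →+ A) :
    Nat.card f.ker * addOrderOf (f 1) = n := by
  have range_eq : f.range = AddSubgroup.zmultiples (f 1) := by
    ext a
    rw [AddMonoidHom.mem_range, ZMod.intCast_surjective.exists, AddSubgroup.mem_zmultiples_iff]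
    simp_rw [← zsmul_one (_ : ℤ), map_zsmul]
  rw [← Nat.card_zmultiples, ← range_eq, ← AddSubgroup.index_ker, AddSubgroup.card_mul_index,
    Nat.card_zmod]

theorem addOrderOf_natCast_pow_zmod [NeZero p] (y j : ℕ) :
    addOrderOf ((p : ZMod (p ^ y)) ^ j) = p ^ (y - j) := by
  rw [← Nat.cast_pow, ZMod.addOrderOf_coe _ (NeZero.ne _)]
  rcases le_total j y with h | h
  · rw [Nat.gcd_eq_right (pow_dvd_pow p h), Nat.pow_div h (NeZero.pos p)]
  · rw [Nat.gcd_eq_left (pow_dvd_pow p h), Nat.div_self (NeZero.pos _), Nat.sub_eq_zero_of_le h,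
      pow_zero]

theorem exists_zmod_hom_card_ker [NeZero p] {x y m : ℕ} (hm : m ≤ x) (hx : x ≤ m + y) :
    ∃ f : ZMod (p ^ x) →+ ZMod (p ^ y), Nat.card f.ker = p ^ m := by
  let image : ZMod (p ^ y) := (p : ZMod (p ^ y)) ^ (y - (x - m))
  have order_image : addOrderOf image = p ^ (x - m) := by
    rw [addOrderOf_natCast_pow_zmod, Nat.sub_sub_self (by lia)]
  have nsmul_image : p ^ x • image = 0 := by
    rw [← addOrderOf_dvd_iff_nsmul_eq_zero, order_image]
    exact pow_dvd_pow p (Nat.sub_le x m)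
  let f : ZMod (p ^ x) →+ ZMod (p ^ y) :=
    ZMod.lift (p ^ x) ⟨zmultiplesHom (ZMod (p ^ y)) image, by simpa using nsmul_image⟩
  refine ⟨f, Nat.eq_of_mul_eq_mul_right (pow_pos (NeZero.pos p) (x - m)) ?_⟩
  have apply_one : f 1 = image := by
    rw [← Int.cast_one, ZMod.lift_coe, zmultiplesHom_apply, one_zsmul]
  rw [← pow_add, Nat.add_sub_cancel' hm, ← order_image, ← apply_one,
    card_ker_mul_addOrderOf_apply_one]

end ZMod

section Constructions

theorem card_ker_mulLeft_mem_fixedPointSpectrum {R : Type*} [Ring R] {c : R} (hc : IsNilpotent c) :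
    Nat.card (AddMonoidHom.mulLeft c).ker ∈ fixedPointSpectrum R := by
  refine ⟨DistribMulAction.toAddEquiv R hc.isUnit_one_add.unit, Nat.card_congr <|
    Equiv.subtypeEquivRight fun x => ?_⟩
  simp [Function.IsFixedPt, AddMonoidHom.mem_ker, Units.smul_def, add_mul]

/-- The fixed points of `(u, v) ↦ (u + g v, f u + v + f (g v))` are `ker f × ker g`. -/
theorem card_ker_mul_card_ker_mem_fixedPointSpectrum {G H : Type*} [AddCommGroup G]
    [AddCommGroup H] (f : G →+ H) (g : H →+ G) :
    Nat.card f.ker * Nat.card g.ker ∈ fixedPointSpectrum (G × H) := by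
  let φ : G × H ≃+ G × H :=
    { toFun w := (w.1 + g w.2, f w.1 + w.2 + f (g w.2))
      invFun w := (w.1 - g (w.2 - f w.1), w.2 - f w.1)
      left_inv w := by ext <;> simp [add_assoc]
      right_inv w := by ext <;> simp
      map_add' w w' := by ext <;> simp <;> abel }
  refine ⟨φ, ?_⟩
  rw [← Nat.card_prod]
  refine Nat.card_congr <| (Equiv.subtypeEquivRight fun w => ?_).trans
    (Equiv.subtypeProdEquivProd (p := (· ∈ f.ker)) (q := (· ∈ g.ker)))
  refine Prod.ext_iff.trans ?_
  simp only [φ, AddEquiv.coe_mk, Equiv.coe_fn_mk, add_eq_left, AddMonoidHom.mem_ker]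
  constructor
  · rintro ⟨hg, hf⟩
    simpa [hg] using hf
  · rintro ⟨hf, hg⟩
    simp [hf, hg]

theorem one_mem_fixedPointSpectrum_prod_prod (G : Type*) [AddCommGroup G] :
    1 ∈ fixedPointSpectrum (G × G × G) := by
  let φ : G × G × G ≃+ G × G × G :=
    { toFun w := (w.2.1, w.2.2, w.1 + w.2.1)
      invFun w := (w.2.2 - w.1, w.1, w.2.1)
      left_inv w := by simp
      right_inv w := by simp
      map_add' w w' := by ext <;> simp; abel }
  refine one_mem_fixedPointSpectrum φ ?_
  rintro ⟨u, v, w⟩ h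
  obtain ⟨rfl, rfl, h⟩ : v = u ∧ w = v ∧ u + v = w := by simpa [φ] using h
  simp_all

theorem one_mem_fixedPointSpectrum_of_odd_card {G : Type*} [AddCommGroup G]
    (hG : Odd (Nat.card G)) : 1 ∈ fixedPointSpectrum G := by
  refine one_mem_fixedPointSpectrum (AddEquiv.neg G) fun x hx => ?_
  have two_nsmul_eq : 2 • x = 0 := by
    rw [two_nsmul]; nth_rw 1 [← hx]; simp
  refine AddMonoid.addOrderOf_eq_one_iff.1 (Nat.eq_one_of_dvd_coprimes hG.coprime_two_left
    (addOrderOf_dvd_of_nsmul_eq_zero two_nsmul_eq) (addOrderOf_dvd_natCard x))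

theorem pow_mem_fixedPointSpectrum_zmod {p k x : ℕ} [NeZero p] (hk : 1 ≤ k) (hkx : k ≤ x) :
    p ^ k ∈ fixedPointSpectrum (ZMod (p ^ x)) := by
  have nilpotent : IsNilpotent ((p : ZMod (p ^ x)) ^ k) := by
    refine ⟨x, ?_⟩
    rw [pow_right_comm, ← Nat.cast_pow, ZMod.natCast_self, zero_pow (by lia)]
  convert card_ker_mulLeft_mem_fixedPointSpectrum nilpotent
  refine Nat.eq_of_mul_eq_mul_right (pow_pos (NeZero.pos p) (x - k)) ?_
  have := card_ker_mul_addOrderOf_apply_one (AddMonoidHom.mulLeft ((p : ZMod (p ^ x)) ^ k))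
  rw [AddMonoidHom.coe_mulLeft, mul_one, addOrderOf_natCast_pow_zmod] at this
  rw [this, ← pow_add, Nat.add_sub_cancel' hkx]

end Constructions

section Odd

theorem fixedPointSpectrum_zmod_prime_pow_of_odd {p k : ℕ} (hp : p.Prime) (hodd : Odd (p ^ k)) :
    fixedPointSpectrum (ZMod (p ^ k)) = (p ^ k).divisors := by
  have : NeZero p := ⟨hp.ne_zero⟩
  ext d
  rw [Finset.mem_coe, Nat.mem_divisors_prime_pow hp]
  constructor
  · intro hd
    exact (Nat.dvd_prime_pow hp).1 (by simpa using dvd_card_of_mem_fixedPointSpectrum hd)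
  · rintro ⟨j, hj, rfl⟩
    rcases j.eq_zero_or_pos with rfl | hj_pos
    · exact one_mem_fixedPointSpectrum_of_odd_card (by simpa using hodd)
    · exact pow_mem_fixedPointSpectrum_zmod hj_pos hj

theorem fixedPointSpectrum_eq_divisors_of_odd_card {G : Type*} [AddCommGroup G]
    (hG : Odd (Nat.card G)) : fixedPointSpectrum G = (Nat.card G).divisors := by
  classical
  refine subset_antisymm (fun d hd => Finset.mem_coe.2 <|
    Nat.mem_divisors.2 ⟨dvd_card_of_mem_fixedPointSpectrum hd, hG.pos.ne'⟩) ?_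
  have : Finite G := Nat.finite_of_card_ne_zero hG.pos.ne'
  obtain ⟨ι, _, p, hp, k, ⟨f⟩⟩ := AddCommGroup.equiv_directSum_zmod_of_finite G
  let g : G ≃+ ∀ i, ZMod (p i ^ k i) := f.trans (DirectSum.addEquivProd _)
  have card_eq : Nat.card G = ∏ i, p i ^ k i := by
    simp [Nat.card_congr g.toEquiv, Nat.card_pi]
  have odd_pow (i : ι) : Odd (p i ^ k i) :=
    hG.of_dvd_nat (card_eq ▸ Finset.dvd_prod_of_mem _ (Finset.mem_univ i))
  calc ((Nat.card G).divisors : Set ℕ) = ∏ i, ((p i ^ k i).divisors : Set ℕ) := by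
        rw [card_eq, Finset.nat_divisors_prod, Finset.coe_prod]
    _ = ∏ i, fixedPointSpectrum (ZMod (p i ^ k i)) := by
        simp_rw [fixedPointSpectrum_zmod_prime_pow_of_odd (hp _) (odd_pow _)]
    _ ⊆ fixedPointSpectrum (∀ i, ZMod (p i ^ k i)) := prod_fixedPointSpectrum_subset_pi
    _ = fixedPointSpectrum G := (fixedPointSpectrum_congr g).symm

end Odd

section ZModPowProd

/-- The product of the groups `ZMod (p ^ x)` over the entries `x` of a list, indexed by the
positions in the list. -/
abbrev ZModPowProd (p : ℕ) (l : List ℕ) : Type := ∀ i : Fin l.length, ZMod (p ^ l.get i)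

namespace ZModPowProd

variable (p x : ℕ) (l l' : List ℕ)

instance : Unique (ZModPowProd p []) := inferInstanceAs (Unique (∀ i : Fin 0, ZMod (p ^ [].get i)))

/-- Splitting off the first factor. -/
def consEquiv : ZMod (p ^ x) × ZModPowProd p l ≃+ ZModPowProd p (x :: l) :=
  (Fin.consLinearEquiv ℤ fun i => ZMod (p ^ (x :: l).get i)).toAddEquiv

/-- A product with a single factor. -/
def singletonEquiv : ZMod (p ^ x) ≃+ ZModPowProd p [x] :=
  AddEquiv.prodUnique.symm.trans (consEquiv p x [])

theorem nonempty_appendEquiv :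
    Nonempty (ZModPowProd p l × ZModPowProd p l' ≃+ ZModPowProd p (l ++ l')) := by
  induction l with
  | nil => exact ⟨AddEquiv.uniqueProd⟩
  | cons x l ih =>
    obtain ⟨f⟩ := ih
    exact ⟨((consEquiv p x l).symm.prodCongr (AddEquiv.refl _)).trans <| AddEquiv.prodAssoc.trans <|
      ((AddEquiv.refl _).prodCongr f).trans (consEquiv p x (l ++ l'))⟩

end ZModPowProd

/-- Every exponent between `lo` and the sum of the list is attained: `p` to that power is the
number of fixed points of an automorphism of `ZModPowProd p l`. -/
def AttainsFixedPointPowers (p : ℕ) (l : List ℕ) (lo : ℕ) : Prop :=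
  lo ≤ l.sum ∧ ∀ m, lo ≤ m → m ≤ l.sum → p ^ m ∈ fixedPointSpectrum (ZModPowProd p l)

namespace AttainsFixedPointPowers

open ZModPowProd

variable {p : ℕ} {l l' : List ℕ} {lo lo' x y : ℕ}

theorem nil : AttainsFixedPointPowers p [] 0 := by
  refine ⟨le_rfl, fun m _ hm => ?_⟩
  obtain rfl : m = 0 := Nat.le_zero.1 hm
  simpa using card_mem_fixedPointSpectrum (G := ZModPowProd p [])

theorem append (h : AttainsFixedPointPowers p l lo) (h' : AttainsFixedPointPowers p l' lo') :
    AttainsFixedPointPowers p (l ++ l') (lo + lo') := by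
  obtain ⟨hlo, h⟩ := h
  obtain ⟨hlo', h'⟩ := h'
  obtain ⟨f⟩ := nonempty_appendEquiv p l l'
  rw [AttainsFixedPointPowers, List.sum_append, ← fixedPointSpectrum_congr f]
  refine ⟨by lia, fun m hm hm' => ?_⟩
  obtain ⟨a, b, rfl, ha, ha', hb, hb'⟩ :
      ∃ a b, m = a + b ∧ lo ≤ a ∧ a ≤ l.sum ∧ lo' ≤ b ∧ b ≤ l'.sum :=
    ⟨min l.sum (m - lo'), m - min l.sum (m - lo'), by lia⟩
  rw [pow_add]
  exact fixedPointSpectrum_mul_subset_prod (Set.mul_mem_mul (h a ha ha') (h' b hb hb'))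

variable [NeZero p]

theorem singleton (hx : 1 ≤ x) : AttainsFixedPointPowers p [x] 1 := by
  rw [AttainsFixedPointPowers, List.sum_singleton, ← fixedPointSpectrum_congr (singletonEquiv p x)]
  exact ⟨hx, fun m => pow_mem_fixedPointSpectrum_zmod⟩

theorem pair : AttainsFixedPointPowers p [x, y] ((x - y) + (y - x)) := by
  rw [AttainsFixedPointPowers, ← fixedPointSpectrum_congr
    (((AddEquiv.refl _).prodCongr (singletonEquiv p y)).trans (consEquiv p x [y])), List.sum_pair]
  refine ⟨by lia, fun m hm hm' => ?_⟩
  obtain ⟨a, b, rfl, hax, hxa, hby, hyb⟩ :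
      ∃ a b, m = a + b ∧ a ≤ x ∧ x ≤ a + y ∧ b ≤ y ∧ y ≤ b + x :=
    ⟨min x (m - (y - x)), m - min x (m - (y - x)), by lia⟩
  obtain ⟨f, hf⟩ := exists_zmod_hom_card_ker (p := p) hax hxa
  obtain ⟨g, hg⟩ := exists_zmod_hom_card_ker (p := p) hby hyb
  rw [pow_add, ← hf, ← hg]
  exact card_ker_mul_card_ker_mem_fixedPointSpectrum f g

theorem triple : AttainsFixedPointPowers p [x, x, x] 0 := by
  refine ⟨Nat.zero_le _, fun m _ hm => ?_⟩
  rcases m.eq_zero_or_pos with rfl | hm_pos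
  · rw [← fixedPointSpectrum_congr (((AddEquiv.refl _).prodCongr (((AddEquiv.refl _).prodCongr
      (singletonEquiv p x)).trans (consEquiv p x [x]))).trans (consEquiv p x [x, x]))]
    exact one_mem_fixedPointSpectrum_prod_prod (ZMod (p ^ x))
  · have hx : 1 ≤ x := by simp only [List.sum_cons, List.sum_nil] at hm; lia
    have h := (singleton (p := p) hx).append (pair (x := x) (y := x))
    exact h.2 m (by lia) hm

theorem replicate (k : ℕ) : AttainsFixedPointPowers p (List.replicate (k + 2) x) 0 := by
  induction k using Nat.twoStepInduction with
  | zero => simpa using pair (p := p) (x := x) (y := x)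
  | one => exact triple
  | more k ih _ => simpa [List.replicate_succ] using (pair (p := p) (x := x) (y := x)).append ih

end AttainsFixedPointPowers

theorem attainsFixedPointPowers_ofFn_iff {p n lo : ℕ} {e : Fin n → ℕ} :
    AttainsFixedPointPowers p (List.ofFn e) lo ↔ lo ≤ ∑ i, e i ∧
      ∀ m, lo ≤ m → m ≤ ∑ i, e i → p ^ m ∈ fixedPointSpectrum (∀ i, ZMod (p ^ e i)) := by
  have spectrum_eq : fixedPointSpectrum (ZModPowProd p (List.ofFn e)) =
      fixedPointSpectrum (∀ i, ZMod (p ^ e i)) :=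
    congrArg (fun s : Σ n, Fin n → ℕ => fixedPointSpectrum (∀ i, ZMod (p ^ s.2 i)))
      (List.equivSigmaTuple.right_inv ⟨n, e⟩)
  rw [AttainsFixedPointPowers, List.sum_ofFn, spectrum_eq]

end ZModPowProd

section Blocks

/-- The least entries of the b-blocks and of the c-blocks: values of multiplicity one in the tuple,
no two of them consecutive. -/
def bcValues : List ABCBlock → List ℕ
  | [] => []
  | .a _ _ :: L => bcValues L
  | .b x :: L => x :: bcValues L
  | .c x :: L => x :: bcValues L

theorem length_bcValues_abcDecomposition {n : ℕ} (e : Fin n → ℕ) :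
    (bcValues (abcDecomposition e)).length = numBBlocks e + numCBlocks e := by
  rw [numBBlocks, numCBlocks]
  induction abcDecomposition e with
  | nil => rfl
  | cons B L ih => cases B <;> grind [bcValues]

theorem exists_eq_replicate_of_mem_splitBy {α : Type*} [DecidableEq α] {l r : List α}
    (hr : r ∈ l.splitBy (· == ·)) : ∃ (k : ℕ) (x : α), r = List.replicate (k + 1) x := by
  have chain : r.IsChain (· = ·) := (List.isChain_of_mem_splitBy hr).imp fun _ _ => by simp
  obtain ⟨x, s, rfl⟩ := List.exists_cons_of_ne_nil (List.ne_nil_of_mem_splitBy hr)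
  exact ⟨s.length, x, congrArg (x :: ·) (List.isChain_cons_eq_iff_eq_replicate.1 chain)⟩

theorem attainsFixedPointPowers_flatten {p : ℕ} [NeZero p] {rs : List (List ℕ)}
    (hrs : ∀ r ∈ rs, ∃ k x, 1 ≤ x ∧ r = List.replicate (k + 1) x) :
    AttainsFixedPointPowers p rs.flatten (bcValues (blocksOfRuns rs)).length := by
  have singleton_attains {x : ℕ} (hx : ∃ k y, 1 ≤ y ∧ [x] = List.replicate (k + 1) y) :
      AttainsFixedPointPowers p [x] 1 := by
    obtain ⟨_, y, hy, hrun⟩ := hx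
    obtain rfl : x = y := (List.cons.inj hrun).1
    exact .singleton hy
  induction rs using blocksOfRuns.induct with
  | case1 => exact .nil
  | case2 t ih => simpa [blocksOfRuns] using ih fun s hs => hrs s (by simp [hs])
  | case3 x y r t ih =>
    have attains := ih fun s hs => hrs s (by simp [hs])
    obtain ⟨k, z, -, hrun⟩ := hrs _ List.mem_cons_self
    obtain ⟨k, rfl⟩ : ∃ j, k = j + 1 := Nat.exists_eq_succ_of_ne_zero (by rintro rfl; simp at hrun)
    simpa [blocksOfRuns, bcValues, hrun] using
      (AttainsFixedPointPowers.replicate (p := p) k).append attains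
  | case4 x t ih =>
    have attains := ih fun s hs => hrs s (by simp [hs])
    simpa [blocksOfRuns, bcValues, add_comm] using
      (AttainsFixedPointPowers.pair (p := p) (x := x) (y := x + 1)).append attains
  | case5 x y t hxy ih =>
    have attains := ih fun s hs => hrs s (List.mem_cons_of_mem _ hs)
    simpa [blocksOfRuns, bcValues, hxy, add_comm] using
      (singleton_attains (hrs [x] List.mem_cons_self)).append attains
  | case6 x t hnot ih =>
    have attains := ih fun s hs => hrs s (by simp [hs])
    simpa [blocksOfRuns, bcValues, hnot, add_comm] using
      (singleton_attains (hrs [x] List.mem_cons_self)).append attains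

theorem pow_mem_fixedPointSpectrum_zmod_pi {p n m : ℕ} [NeZero p] {e : Fin n → ℕ}
    (he : ∀ i, 1 ≤ e i) (hm : numBBlocks e + numCBlocks e ≤ m) (hm' : m ≤ ∑ i, e i) :
    p ^ m ∈ fixedPointSpectrum (∀ i, ZMod (p ^ e i)) := by
  have runs_pos : ∀ r ∈ (List.ofFn e).splitBy (· == ·),
      ∃ k x, 1 ≤ x ∧ r = List.replicate (k + 1) x := by
    intro r hr
    obtain ⟨k, x, rfl⟩ := exists_eq_replicate_of_mem_splitBy hr
    have hx : x ∈ List.ofFn e := by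
      rw [← List.flatten_splitBy (· == ·) (List.ofFn e)]
      exact List.mem_flatten_of_mem hr (by simp)
    exact ⟨k, x, List.forall_mem_ofFn_iff.2 he x hx, rfl⟩
  have attains := attainsFixedPointPowers_flatten (p := p) runs_pos
  rw [List.flatten_splitBy, attainsFixedPointPowers_ofFn_iff] at attains
  exact attains.2 m ((length_bcValues_abcDecomposition e).trans_le hm) hm'

theorem singleton_mem_of_mem_bcValues {rs : List (List ℕ)} {x : ℕ}
    (hx : x ∈ bcValues (blocksOfRuns rs)) : [x] ∈ rs := by
  induction rs using blocksOfRuns.induct <;> grind [blocksOfRuns, bcValues]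

end Blocks

section Sparse

theorem add_one_lt_of_singleton_mem {t : List (List ℕ)} {x z : ℕ} (hnil : [] ∉ t)
    (hlt : ([x] :: t).Pairwise fun r s => ∀ a ∈ r, ∀ b ∈ s, a < b)
    (hne : t.head? ≠ some [x + 1]) (hz : [z] ∈ t) : x + 1 < z := by
  rcases t with _ | ⟨_ | ⟨y, r⟩, t⟩
  · exact absurd hz List.not_mem_nil
  · exact absurd List.mem_cons_self hnil
  have hxy : x < y := List.rel_of_pairwise_cons hlt List.mem_cons_self x
    (List.mem_singleton_self x) y List.mem_cons_self
  rcases List.mem_cons.1 hz with hzy | hzt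
  · obtain ⟨rfl, rfl⟩ := List.cons.inj hzy
    have hzx : z ≠ x + 1 := by simpa using hne
    lia
  · have hyz : y < z := List.rel_of_pairwise_cons hlt.of_cons hzt y List.mem_cons_self z
      (List.mem_singleton_self z)
    lia

theorem pairwise_add_one_lt_bcValues {rs : List (List ℕ)} (hnil : [] ∉ rs)
    (hlt : rs.Pairwise fun r s => ∀ a ∈ r, ∀ b ∈ s, a < b) :
    (bcValues (blocksOfRuns rs)).Pairwise fun x y => x + 1 < y := by
  induction rs using blocksOfRuns.induct with
  | case1 => exact .nil
  | case2 t => simp at hnil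
  | case3 x y r t ih => exact ih (by simp_all) hlt.of_cons
  | case4 x t ih =>
    simp only [blocksOfRuns, if_true, bcValues]
    refine List.pairwise_cons.2 ⟨fun z hz => ?_, ih (by simp_all) hlt.of_cons.of_cons⟩
    exact List.rel_of_pairwise_cons hlt.of_cons (singleton_mem_of_mem_bcValues hz) (x + 1)
      (List.mem_singleton_self _) z (List.mem_singleton_self _)
  | case5 x y t hxy ih =>
    rw [blocksOfRuns, if_neg hxy, bcValues]
    have hnil' : [] ∉ [y] :: t := fun h => hnil (List.mem_cons_of_mem _ h)
    exact List.pairwise_cons.2 ⟨fun z hz => add_one_lt_of_singleton_mem hnil' hlt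
      (by simpa using hxy) (singleton_mem_of_mem_bcValues hz), ih hnil' hlt.of_cons⟩
  | case6 x t hnot ih =>
    rw [blocksOfRuns.eq_5 _ _ hnot, bcValues]
    have hnil' : [] ∉ t := fun h => hnil (List.mem_cons_of_mem _ h)
    have hhead : t.head? ≠ some [x + 1] := fun h => by
      obtain ⟨s, rfl⟩ := List.head?_eq_some_iff.1 h
      exact hnot _ _ rfl
    exact List.pairwise_cons.2 ⟨fun z hz => add_one_lt_of_singleton_mem hnil' hlt hhead
      (singleton_mem_of_mem_bcValues hz), ih hnil' hlt.of_cons⟩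

theorem pairwise_lt_splitBy {α : Type*} [PartialOrder α] [DecidableEq α] {l : List α}
    (hl : l.SortedLE) :
    (l.splitBy (· == ·)).Pairwise fun r s => ∀ a ∈ r, ∀ b ∈ s, a < b := by
  have le_of_mem : (l.splitBy (· == ·)).Pairwise fun r s => ∀ a ∈ r, ∀ b ∈ s, a ≤ b := by
    have sorted := hl.pairwise
    rw [← List.flatten_splitBy (· == ·) l, List.pairwise_flatten] at sorted
    exact sorted.2
  have const : ∀ r ∈ l.splitBy (· == ·), ∀ a ∈ r, ∀ b ∈ r, a = b := by
    intro r hr a ha b hb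
    obtain ⟨k, x, rfl⟩ := exists_eq_replicate_of_mem_splitBy hr
    rw [List.eq_of_mem_replicate ha, List.eq_of_mem_replicate hb]
  have chain := List.isChain_getLast_head_splitBy (· == ·) l
  generalize l.splitBy (· == ·) = rs at *
  induction rs with
  | nil => exact .nil
  | cons r rs ih =>
    have tail_lt := ih le_of_mem.of_cons (fun s hs => const s (List.mem_cons_of_mem _ hs))
      chain.of_cons
    refine List.pairwise_cons.2 ⟨?_, tail_lt⟩
    rcases rs with _ | ⟨s, rs⟩
    · simp
    obtain ⟨hr, hs, last_ne_head⟩ := (List.isChain_cons_cons.1 chain).1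
    have next_lt : ∀ a ∈ r, ∀ b ∈ s, a < b := by
      intro a ha b hb
      refine (List.rel_of_pairwise_cons le_of_mem List.mem_cons_self a ha b hb).lt_of_ne ?_
      rw [const r List.mem_cons_self a ha _ (List.getLast_mem hr),
        const s (by simp) b hb _ (List.head_mem hs)]
      simpa using last_ne_head
    intro u hu a ha b hb
    rcases List.mem_cons.1 hu with rfl | hu
    · exact next_lt a ha b hb
    · exact (next_lt a ha _ (List.head_mem hs)).trans
        (List.rel_of_pairwise_cons tail_lt hu _ (List.head_mem hs) b hb)

theorem existsUnique_eq_of_count_ofFn_eq_one {α : Type*} [DecidableEq α] {n : ℕ} {e : Fin n → α}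
    {t : α} (ht : (List.ofFn e).count t = 1) : ∃! i, e i = t := by
  rw [List.ofFn_eq_map, List.count, List.countP_map, List.countP_eq_length_filter,
    List.length_eq_one_iff] at ht
  obtain ⟨i, hi⟩ := ht
  have eq_iff (j : Fin n) : e j = t ↔ j = i := by
    rw [← List.mem_singleton (b := i), ← hi]
    simp
  exact ⟨i, (eq_iff i).2 rfl, fun j => (eq_iff j).1⟩

theorem count_flatten_of_singleton_mem {α : Type*} [Preorder α] [DecidableEq α]
    {rs : List (List α)} {x : α}
    (hlt : rs.Pairwise fun r s => ∀ a ∈ r, ∀ b ∈ s, a < b) (hx : [x] ∈ rs) :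
    rs.flatten.count x = 1 := by
  obtain ⟨us, vs, rfl⟩ := List.append_of_mem hx
  obtain ⟨-, hvs, hus⟩ := List.pairwise_append.1 hlt
  have not_mem_us : x ∉ us.flatten := by
    simp only [List.mem_flatten, not_exists, not_and]
    exact fun r hr hxr => (hus r hr [x] List.mem_cons_self x hxr x List.mem_cons_self).false
  have not_mem_vs : x ∉ vs.flatten := by
    simp only [List.mem_flatten, not_exists, not_and]
    exact fun r hr hxr => (List.rel_of_pairwise_cons hvs hr x List.mem_cons_self x hxr).false
  simp [List.count_eq_zero.2 not_mem_us, List.count_eq_zero.2 not_mem_vs]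

theorem exists_sparse_finset_of_monotone {n : ℕ} {e : Fin n → ℕ} (he : Monotone e) :
    ∃ T : Finset ℕ, T.card = numBBlocks e + numCBlocks e ∧
      (∀ t ∈ T, ∃! i, e i = t) ∧ ∀ t ∈ T, t + 1 ∉ T := by
  have runs_lt := pairwise_lt_splitBy he.sortedLE_ofFn
  have values_lt : (bcValues (abcDecomposition e)).Pairwise fun x y => x + 1 < y :=
    pairwise_add_one_lt_bcValues (List.nil_notMem_splitBy _ _) runs_lt
  have values_nodup : (bcValues (abcDecomposition e)).Nodup := values_lt.imp fun h => by lia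
  refine ⟨(bcValues (abcDecomposition e)).toFinset, ?_, fun t ht => ?_, fun t ht ht' => ?_⟩
  · rw [List.toFinset_card_of_nodup values_nodup, length_bcValues_abcDecomposition]
  · refine existsUnique_eq_of_count_ofFn_eq_one ?_
    rw [← List.flatten_splitBy (· == ·) (List.ofFn e)]
    exact count_flatten_of_singleton_mem runs_lt
      (singleton_mem_of_mem_bcValues (List.mem_toFinset.1 ht))
  · rw [List.mem_toFinset] at ht ht'
    exact List.Pairwise.forall_of_forall_of_flip (R := fun x y => y ≠ x + 1) (fun _ _ => by lia)
      (values_lt.imp fun h => by lia) (values_lt.imp fun h => by dsimp only [flip]; lia) ht ht' rfl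

end Sparse

section LowerBound

theorem index_dvd_card_ker_mul_index {G : Type*} [AddGroup G] [Finite G] {f : G →+ G}
    {U V : AddSubgroup G} (h : U.map f ≤ V) : V.index ∣ Nat.card f.ker * U.index := by
  calc V.index ∣ (U.map f).index := AddSubgroup.index_dvd_of_le h
    _ = Nat.card f.ker * (U ⊔ f.ker).index := by
      rw [AddSubgroup.index_map, AddSubgroup.index_range, mul_comm]
    _ ∣ Nat.card f.ker * U.index := mul_dvd_mul_left _ (AddSubgroup.index_dvd_of_le le_sup_left)

theorem pow_sub_dvd_of_pow_mul_eq_zero {p k m : ℕ} [NeZero p] {u : ZMod (p ^ m)}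
    (h : (p : ZMod (p ^ m)) ^ k * u = 0) : (p : ZMod (p ^ m)) ^ (m - k) ∣ u := by
  obtain ⟨z, rfl⟩ := ZMod.intCast_surjective u
  have pow_dvd : (p : ℤ) ^ m ∣ p ^ k * z := by
    exact_mod_cast (ZMod.intCast_zmod_eq_zero_iff_dvd (p ^ k * z) (p ^ m)).1 (by exact_mod_cast h)
  suffices (p : ℤ) ^ (m - k) ∣ z by simpa using map_dvd (Int.castRingHom (ZMod (p ^ m))) this
  rcases le_total m k with hmk | hkm
  · simp [Nat.sub_eq_zero_of_le hmk]
  · rw [← Nat.add_sub_cancel' hkm, pow_add] at pow_dvd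
    exact (mul_dvd_mul_iff_left (pow_ne_zero k (NeZero.ne _))).1 pow_dvd

theorem two_dvd_sub_one_of_not_two_dvd {n : ℕ} {u : ZMod n} (hu : ¬ 2 ∣ u) : 2 ∣ u - 1 := by
  obtain ⟨z, rfl⟩ := ZMod.intCast_surjective u
  rcases Int.even_or_odd' z with ⟨k, rfl | rfl⟩
  · exact absurd (by simp) hu
  · simp

section PowMultiples

variable {ι : Type*} {p : ℕ} {e c b : ι → ℕ}

/-- The subgroup of vectors whose `i`-th coordinate is a multiple of `p ^ c i`, of index `p ^ ∑ c i`
when `c ≤ e`. -/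
def powMultiples (p : ℕ) (e c : ι → ℕ) : AddSubgroup (∀ i, ZMod (p ^ e i)) :=
  AddSubgroup.pi Set.univ fun i => AddSubgroup.zmultiples ((p : ZMod (p ^ e i)) ^ c i)

theorem mem_powMultiples {x : ∀ i, ZMod (p ^ e i)} :
    x ∈ powMultiples p e c ↔ ∀ i, (p : ZMod (p ^ e i)) ^ c i ∣ x i := by
  simp only [powMultiples, AddSubgroup.mem_pi, Set.mem_univ, true_imp_iff]
  refine forall_congr' fun i => ?_
  simp_rw [AddSubgroup.mem_zmultiples_iff, dvd_def, ZMod.intCast_surjective.exists, zsmul_eq_mul,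
    mul_comm, eq_comm]

theorem index_powMultiples [Fintype ι] [NeZero p] (hc : ∀ i, c i ≤ e i) :
    (powMultiples p e c).index = p ^ ∑ i, c i := by
  have card_eq : Nat.card (powMultiples p e c) = ∏ i, p ^ (e i - c i) := by
    simp_rw [← addOrderOf_natCast_pow_zmod, ← Nat.card_zmultiples, ← Nat.card_pi]
    exact Nat.card_congr (Equiv.Set.univPi _)
  refine Nat.eq_of_mul_eq_mul_left (n := Nat.card (powMultiples p e c)) Nat.card_pos ?_
  rw [AddSubgroup.card_mul_index, card_eq, ← Finset.prod_pow_eq_pow_sum, ← Finset.prod_mul_distrib,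
    Nat.card_pi]
  simp_rw [Nat.card_zmod, ← pow_add, Nat.sub_add_cancel (hc _)]

theorem map_powMultiples_le [Finite ι] [DecidableEq ι]
    {f : (∀ i, ZMod (p ^ e i)) →+ ∀ i, ZMod (p ^ e i)}
    (h : ∀ i j, (p : ZMod (p ^ e i)) ^ b i ∣ (p : ZMod (p ^ e i)) ^ c j * f (Pi.single j 1) i) :
    (powMultiples p e c).map f ≤ powMultiples p e b := by
  rw [AddSubgroup.map_le_iff_le_comap, powMultiples, AddSubgroup.pi_le_iff]
  intro j
  rw [AddMonoidHom.map_zmultiples, AddSubgroup.zmultiples_le, AddSubgroup.mem_comap,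
    mem_powMultiples]
  intro i
  have single_eq : Pi.single j ((p : ZMod (p ^ e j)) ^ c j) =
      p ^ c j • (Pi.single j 1 : ∀ i, ZMod (p ^ e i)) := by
    rw [← Pi.single_smul]; simp
  rw [AddMonoidHom.single_apply, single_eq, map_nsmul, Pi.smul_apply, nsmul_eq_mul, Nat.cast_pow]
  exact h i j

theorem pow_sub_dvd_apply_single [DecidableEq ι] [NeZero p]
    (f : (∀ i, ZMod (p ^ e i)) →+ ∀ i, ZMod (p ^ e i)) (i j : ι) :
    (p : ZMod (p ^ e i)) ^ (e i - e j) ∣ f (Pi.single j 1) i := by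
  refine pow_sub_dvd_of_pow_mul_eq_zero ?_
  have nsmul_single : p ^ e j • (Pi.single j 1 : ∀ i, ZMod (p ^ e i)) = 0 := by
    rw [← Pi.single_smul, nsmul_eq_mul, ZMod.natCast_self, zero_mul, Pi.single_zero]
  rw [← Nat.cast_pow, ← nsmul_eq_mul, ← Pi.smul_apply, ← map_nsmul, nsmul_single, map_zero,
    Pi.zero_apply]

theorem not_dvd_apply_single_self [Finite ι] [DecidableEq ι] [NeZero p] (hp : 1 < p)
    (φ : (∀ i, ZMod (p ^ e i)) ≃+ ∀ i, ZMod (p ^ e i)) {i : ι} (hi : 1 ≤ e i)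
    (huniq : ∀ j, e j = e i → j = i) : ¬ (p : ZMod (p ^ e i)) ∣ φ (Pi.single i 1) i := by
  -- Otherwise `φ` would embed a subgroup into one of strictly larger index.
  intro dvd_diagonal
  have := Fintype.ofFinite ι
  let b (j : ι) : ℕ := if e i ≤ e j then 1 else 0
  let c (j : ι) : ℕ := if e i < e j then 1 else 0
  have map_le : (powMultiples p e c).map φ.toAddMonoidHom ≤ powMultiples p e b := by
    refine map_powMultiples_le fun k j => ?_
    by_cases hk : e i ≤ e k; swap
    · simp [b, hk]
    by_cases hj : e i < e j
    · simp [b, c, hk, hj]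
    simp only [b, c, hk, hj, if_true, if_false, pow_one, pow_zero, one_mul]
    by_cases hjk : e j < e k
    · exact (dvd_pow_self _ (by lia)).trans (pow_sub_dvd_apply_single φ.toAddMonoidHom k j)
    · obtain rfl : j = i := huniq j (by lia)
      obtain rfl : k = j := huniq k (by lia)
      exact dvd_diagonal
  have card_ker : Nat.card φ.toAddMonoidHom.ker = 1 :=
    AddSubgroup.card_eq_one.2 ((AddMonoidHom.ker_eq_bot_iff _).2 φ.injective)
  have index_dvd := index_dvd_card_ker_mul_index map_le
  rw [card_ker, one_mul, index_powMultiples fun j => by grind,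
    index_powMultiples fun j => by grind, Nat.pow_dvd_pow_iff_le_right hp] at index_dvd
  exact index_dvd.not_gt (Finset.sum_lt_sum (fun j _ => by grind) ⟨i, Finset.mem_univ i, by grind⟩)

end PowMultiples

theorem count_succ_le_count_add_sub {P : ℕ → Prop} [DecidablePred P] (hP : ∀ t, P t → ¬ P (t + 1))
    {u v : ℕ} (h : u ≠ v ∨ ¬ P v) : Nat.count P (v + 1) ≤ Nat.count P u + (v - u) := by
  rcases lt_trichotomy v u with hvu | rfl | huv
  · exact (Nat.count_monotone P hvu).trans (Nat.le_add_right _ _)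
  · simp [Nat.count_succ, h.resolve_left (not_not.2 rfl)]
  · induction v, huv using Nat.le_induction with
    | base => grind
    | succ v huv ih => grind

theorem count_succ_le_self {P : ℕ → Prop} [DecidablePred P] (h0 : ¬ P 0) (v : ℕ) :
    Nat.count P (v + 1) ≤ v := by
  simpa [Nat.count_succ', h0] using Nat.count_le (fun k => P (k + 1)) (n := v)

theorem sum_ite_mem_eq_card_of_existsUnique {ι : Type*} [Fintype ι] {e : ι → ℕ} {T : Finset ℕ}
    (hT : ∀ t ∈ T, ∃! i, e i = t) : ∑ i, (if e i ∈ T then 1 else 0) = T.card := by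
  rw [← Finset.card_filter]
  refine Finset.card_bij (fun i _ => e i) (fun i hi => (Finset.mem_filter.1 hi).2)
    (fun i hi j _ hij => (hT _ (Finset.mem_filter.1 hi).2).unique rfl hij.symm) fun t ht => ?_
  obtain ⟨i, rfl, -⟩ := hT t ht
  exact ⟨i, by simpa using ht, rfl⟩

section SparseExponents

variable {ι : Type*} [Finite ι] {e : ι → ℕ} {T : Finset ℕ}

theorem two_pow_count_dvd_sub_id_apply_single [DecidableEq ι] (he : ∀ i, 1 ≤ e i)
    (hT : ∀ t ∈ T, ∃! i, e i = t) (hT' : ∀ t ∈ T, t + 1 ∉ T)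
    (φ : (∀ i, ZMod (2 ^ e i)) ≃+ ∀ i, ZMod (2 ^ e i)) (i j : ι) :
    ((2 : ℕ) : ZMod (2 ^ e i)) ^ Nat.count (· ∈ T) (e i + 1) ∣
      ((2 : ℕ) : ZMod (2 ^ e i)) ^ Nat.count (· ∈ T) (e j) *
        (φ.toAddMonoidHom - AddMonoidHom.id (∀ i, ZMod (2 ^ e i))) (Pi.single j 1) i := by
  by_cases hij : j = i ∧ e i ∈ T
  · obtain ⟨rfl, hj⟩ := hij
    have diagonal_odd := two_dvd_sub_one_of_not_two_dvd
      (not_dvd_apply_single_self one_lt_two φ (he j) fun k hk => (hT _ hj).unique hk rfl)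
    rw [Nat.count_succ, if_pos hj, pow_succ]
    exact mul_dvd_mul_left _ (by simpa using diagonal_odd)
  · have count_le : Nat.count (· ∈ T) (e i + 1) ≤ Nat.count (· ∈ T) (e j) + (e i - e j) :=
      count_succ_le_count_add_sub hT' <| by
        by_contra! h
        exact hij ⟨(hT _ h.2).unique h.1 rfl, h.2⟩
    refine (pow_dvd_pow _ count_le).trans ?_
    rw [pow_add]
    exact mul_dvd_mul_left _ (pow_sub_dvd_apply_single _ i j)

theorem two_pow_card_dvd_of_mem_fixedPointSpectrum (he : ∀ i, 1 ≤ e i)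
    (hT : ∀ t ∈ T, ∃! i, e i = t) (hT' : ∀ t ∈ T, t + 1 ∉ T) {d : ℕ}
    (hd : d ∈ fixedPointSpectrum (∀ i, ZMod (2 ^ e i))) : 2 ^ T.card ∣ d := by
  classical
  have := Fintype.ofFinite ι
  obtain ⟨φ, rfl⟩ := hd
  let a (i : ι) : ℕ := Nat.count (· ∈ T) (e i)
  let b (i : ι) : ℕ := Nat.count (· ∈ T) (e i + 1)
  have zero_notMem : 0 ∉ T := fun h => by
    obtain ⟨i, hi, -⟩ := hT 0 h
    exact absurd (he i) (by lia)
  have b_le (i : ι) : b i ≤ e i := count_succ_le_self zero_notMem (e i)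
  have a_le (i : ι) : a i ≤ e i := Nat.count_le _
  have sum_b : ∑ i, b i = T.card + ∑ i, a i := by
    simp only [a, b, Nat.count_succ, Finset.sum_add_distrib,
      sum_ite_mem_eq_card_of_existsUnique hT, add_comm]
  have map_le : (powMultiples 2 e a).map (φ.toAddMonoidHom - AddMonoidHom.id _) ≤
      powMultiples 2 e b :=
    map_powMultiples_le (two_pow_count_dvd_sub_id_apply_single he hT hT' φ)
  have card_ker : Nat.card (φ.toAddMonoidHom - AddMonoidHom.id _).ker =
      Nat.card (Function.fixedPoints φ) :=
    Nat.card_congr (Equiv.subtypeEquivRight fun x => sub_eq_zero)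
  have index_dvd := index_dvd_card_ker_mul_index map_le
  rw [index_powMultiples b_le, index_powMultiples a_le, sum_b, pow_add, card_ker] at index_dvd
  exact Nat.dvd_of_mul_dvd_mul_right (by positivity) index_dvd

end SparseExponents

end LowerBound

section Assembly

theorem fixedPointSpectrum_zmod_two_pow_pi {n : ℕ} {e : Fin n → ℕ} (hmono : Monotone e)
    (he : ∀ i, 1 ≤ e i) : fixedPointSpectrum (∀ i, ZMod (2 ^ e i)) =
      {d | 2 ^ (numBBlocks e + numCBlocks e) ∣ d ∧ d ∣ Nat.card (∀ i, ZMod (2 ^ e i))} := by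
  ext d
  constructor
  · intro hd
    obtain ⟨T, card_eq, hT, hT'⟩ := exists_sparse_finset_of_monotone hmono
    refine ⟨card_eq ▸ two_pow_card_dvd_of_mem_fixedPointSpectrum he hT hT' hd,
      dvd_card_of_mem_fixedPointSpectrum hd⟩
  · rintro ⟨dvd_d, d_dvd⟩
    obtain ⟨m, hm, rfl⟩ := (Nat.dvd_prime_pow (m := ∑ i, e i) Nat.prime_two).1 <| by
      simpa [Finset.prod_pow_eq_pow_sum] using d_dvd
    exact pow_mem_fixedPointSpectrum_zmod_pi he
      ((Nat.pow_dvd_pow_iff_le_right one_lt_two).1 dvd_d) hm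

theorem setOf_dvd_mul_divisors {k m M : ℕ} (hm : m ≠ 0) (hkm : k.Coprime m) :
    {d | k ∣ d ∧ d ∣ M} * (m.divisors : Set ℕ) = {d | k ∣ d ∧ d ∣ M * m} := by
  ext d
  simp only [Set.mem_mul, Set.mem_ofPred_eq, Finset.mem_coe, Nat.mem_divisors]
  constructor
  · rintro ⟨a, ⟨hka, haM⟩, b, ⟨hb, -⟩, rfl⟩
    exact ⟨hka.mul_right b, mul_dvd_mul haM hb⟩
  · rintro ⟨hk, hd⟩
    obtain ⟨a, b, ha, hb, rfl⟩ := exists_dvd_and_dvd_of_dvd_mul hd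
    exact ⟨a, ⟨(hkm.of_dvd_right hb).dvd_of_dvd_mul_right hk, ha⟩, b, ⟨hb, hm⟩, rfl⟩

theorem exists_sylow_prod_mulEquiv {A : Type*} [CommGroup A] [Finite A] {p : ℕ} [Fact p.Prime]
    (S : Sylow p A) : ∃ K : Subgroup A, ¬ p ∣ Nat.card K ∧ Nonempty (S × K ≃* A) := by
  obtain ⟨K, hK⟩ := Subgroup.exists_right_complement'_of_coprime S.card_coprime_index
  refine ⟨K, hK.symm.index_eq_card ▸ S.not_dvd_index, ⟨MulEquiv.ofBijective
    ((S : Subgroup A).subtype.coprod K.subtype) hK⟩⟩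

end Assembly

theorem mainTheorem1 {A : Type*} [CommGroup A] [Finite A] {n : ℕ} (e : Fin n → ℕ)
    (S : Sylow 2 A) (hS : IsOfType 2 e S) :
    reidemeisterSpectrum A =
      ((↑) : ℕ → ℕ∞) ''
        {d : ℕ | d ∣ Nat.card A ∧ numBBlocks e + numCBlocks e ≤ padicValNat 2 d} := by
  obtain ⟨hmono, he, ⟨f⟩⟩ := hS
  obtain ⟨K, hK, ⟨g⟩⟩ := exists_sylow_prod_mulEquiv S
  let h : Additive A ≃+ (∀ i, ZMod (2 ^ e i)) × Additive K :=
    (MulEquiv.toAdditive g.symm).trans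
      ((AddEquiv.prodAdditive _ _).trans ((MulEquiv.toAdditiveLeft f).prodCongr (.refl _)))
  have odd_card : Odd (Nat.card (Additive K)) := Nat.not_even_iff_odd.1 (mt Even.two_dvd hK)
  have coprime_pow (k : ℕ) : (2 ^ k).Coprime (Nat.card (Additive K)) :=
    odd_card.coprime_two_left.pow_left k
  have coprime_card : (Nat.card (∀ i, ZMod (2 ^ e i))).Coprime (Nat.card (Additive K)) := by
    simpa [Finset.prod_pow_eq_pow_sum] using coprime_pow (∑ i, e i)
  have card_A : Nat.card A = Nat.card (∀ i, ZMod (2 ^ e i)) * Nat.card (Additive K) :=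
    (Nat.card_congr h.toEquiv).trans (Nat.card_prod _ _)
  rw [reidemeisterSpectrum_eq_image_fixedPointSpectrum, fixedPointSpectrum_congr h,
    fixedPointSpectrum_prod_of_coprime_card coprime_card,
    fixedPointSpectrum_zmod_two_pow_pi hmono he,
    fixedPointSpectrum_eq_divisors_of_odd_card odd_card,
    setOf_dvd_mul_divisors odd_card.pos.ne' (coprime_pow _), ← card_A]
  refine congrArg _ (Set.ext fun d => and_comm.trans (and_congr_right fun hd => ?_))
  exact padicValNat_dvd_iff_le (ne_zero_of_dvd_ne_zero Nat.card_pos.ne' hd)
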